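/- Let $[m]=\{1,\dots,m\}$. A permutation $\pi=(\pi_1,\dots,\pi_m)$ of $[m]$ is a Baxter permutation if there are no indices $i<j$, $j+1<k$ with $\pi_{j+1}<\pi_i<\pi_k<\pi_j$ or with $\pi_{j+1}>\pi_i>\pi_k>\pi_j$. It is alternating if $\pi_1<\pi_2>\pi_3<\pi_4>\cdots$, that is, $\pi_{2i-1}<\pi_{2i}$ and $\pi_{2i}>\pi_{2i+1}$ whenever these indices lie in $[m]$. Let $C_r=\frac{1}{r+1}\binom{2r}{r}$ denote the $r$-th Catalan number. Let $k\ge 1$ be an integer. The number of permutations of $[n-1]$ that are both alternating and Baxter is $C_{k-1}C_k$ if $n=2k$, and $C_{k-1}C_{k-1}$ if $n=2k-1$. -/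

import Mathlib

namespace AltBaxter

/-- A permutation `π` of an `m`-element chain is Baxter if it avoids the vincular patterns
2-41-3 and 3-14-2: there are no positions `i < j`, `j + 1 < k` with
`π (j+1) < π i < π k < π j`, nor with `π (j+1) > π i > π k > π j`.
Here `j'` is the position `j + 1`. -/
def IsBaxter {m : ℕ} (π : Equiv.Perm (Fin m)) : Prop :=
  ∀ i j j' k : Fin m, i < j → (j' : ℕ) = (j : ℕ) + 1 → j' < k →
    ¬ (π j' < π i ∧ π i < π k ∧ π k < π j) ∧
    ¬ (π j' > π i ∧ π i > π k ∧ π k > π j)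

/-- A permutation is alternating if `a₁ < a₂ > a₃ < a₄ > ⋯`. Positions in `Fin m` start at `0`,
so the entry `a₁` is the value at position `0`: steps leaving an even position are rises and
steps leaving an odd position are descents. -/
def IsAlternating {m : ℕ} (π : Equiv.Perm (Fin m)) : Prop :=
  ∀ i i' : Fin m, (i' : ℕ) = (i : ℕ) + 1 →
    (Even (i : ℕ) → π i < π i') ∧ (Odd (i : ℕ) → π i > π i')

end AltBaxter

/-! Build permutations by appending last entries, and label each Baxter permutation by `(i, j)`, its
numbers of right-to-left minima and maxima. An entry appended as a descent keeps the Baxter property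
exactly when it is placed just below a right-to-left minimum (`avoidsLast_castSucc_iff`), so the new
labels are `(i', j + 1)` with `1 ≤ i' ≤ i` (`sum_descent`). By complementation a rise gives `(i + 1,
j')` with `1 ≤ j' ≤ j` (`sum_ascent`).

In an alternating permutation rises and descents alternate. A rise followed by a descent replaces
`i` by any of `1, …, i + 1` and `j`, independently, by any of `2, …, j + 1`. The count therefore
factors into two Catalan-tree counts (`weight_odd_length`), evaluated by `ballot_one` and
`shiftedBallot_one`. -/

namespace AltBaxter

open Finset

/-! ### Appending a last entry to a permutation -/

/-- The permutation with last entry `v` whose other entries are order-isomorphic to `π`. -/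
def appendLast {m : ℕ} (π : Equiv.Perm (Fin m)) (v : Fin (m + 1)) : Equiv.Perm (Fin (m + 1)) :=
  ((finSuccEquiv' (Fin.last m)).trans (Equiv.optionCongr π)).trans (finSuccEquiv' v).symm

@[simp]
theorem appendLast_castSucc {m : ℕ} (π : Equiv.Perm (Fin m)) (v : Fin (m + 1)) (i : Fin m) :
    appendLast π v i.castSucc = v.succAbove (π i) := by
  have h : finSuccEquiv' (Fin.last m) i.castSucc = some i := by
    rw [← Fin.succAbove_last_apply]; exact finSuccEquiv'_succAbove _ _
  simp [appendLast, h]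

@[simp]
theorem appendLast_last {m : ℕ} (π : Equiv.Perm (Fin m)) (v : Fin (m + 1)) :
    appendLast π v (Fin.last m) = v := by
  simp [appendLast]

theorem appendLast_bijective (m : ℕ) :
    Function.Bijective
      (fun p : Equiv.Perm (Fin m) × Fin (m + 1) => appendLast p.1 p.2) := by
  rw [Fintype.bijective_iff_injective_and_card]
  constructor
  · rintro ⟨π, v⟩ ⟨ρ, w⟩ h
    have hv : v = w := by
      have := congrArg (fun σ : Equiv.Perm (Fin (m + 1)) => σ (Fin.last m)) h
      simpa using this
    subst hv
    have hπ : π = ρ := by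
      ext1 i
      have := congrArg (fun σ : Equiv.Perm (Fin (m + 1)) => σ i.castSucc) h
      simpa using this
    rw [hπ]
  · simp [Fintype.card_perm, Nat.factorial_succ, mul_comm]

theorem sum_perm_succ {m : ℕ} (F : Equiv.Perm (Fin (m + 1)) → ℕ) :
    ∑ σ, F σ = ∑ π : Equiv.Perm (Fin m), ∑ v, F (appendLast π v) := by
  rw [← Fintype.sum_prod_type' (f := fun π v => F (appendLast π v))]
  exact ((appendLast_bijective m).sum_comp F).symm

/-- No occurrence of a forbidden pattern of `appendLast π v` uses the new last entry `v`. -/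
def AvoidsLast {m : ℕ} (π : Equiv.Perm (Fin m)) (v : Fin (m + 1)) : Prop :=
  ∀ i j j' : Fin m, i < j → (j' : ℕ) = (j : ℕ) + 1 →
    ¬ (π j' < π i ∧ (π i).castSucc < v ∧ v ≤ (π j).castSucc) ∧
    ¬ (π i < π j' ∧ v ≤ (π i).castSucc ∧ (π j).castSucc < v)

theorem isBaxter_appendLast {m : ℕ} (π : Equiv.Perm (Fin m)) (v : Fin (m + 1)) :
    IsBaxter (appendLast π v) ↔ IsBaxter π ∧ AvoidsLast π v := by
  constructor
  · intro h
    constructor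
    · intro i j j' k hij hj hk
      have := h i.castSucc j.castSucc j'.castSucc k.castSucc (by simpa) (by simpa) (by simpa)
      simpa [Fin.succAbove_lt_succAbove_iff] using this
    · intro i j j' hij hj
      have := h i.castSucc j.castSucc j'.castSucc (Fin.last m) (by simpa) (by simpa)
        (Fin.castSucc_lt_last _)
      simpa [Fin.succAbove_lt_succAbove_iff, Fin.succAbove_lt_iff_castSucc_lt,
        Fin.lt_succAbove_iff_le_castSucc] using this
  · rintro ⟨h₁, h₂⟩ i j j' k hij hj hk
    obtain ⟨j', rfl⟩ := Fin.exists_castSucc_eq.2 (ne_of_lt (hk.trans_le (Fin.le_last k)))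
    have hjj' : j < j'.castSucc := by rw [Fin.lt_def]; omega
    obtain ⟨j, rfl⟩ := Fin.exists_castSucc_eq.2 (ne_of_lt (hjj'.trans_le (Fin.le_last _)))
    obtain ⟨i, rfl⟩ := Fin.exists_castSucc_eq.2 (ne_of_lt (hij.trans_le (Fin.le_last _)))
    simp only [Fin.castSucc_lt_castSucc_iff, Fin.val_castSucc] at hij hj
    induction k using Fin.lastCases with
    | last =>
      simpa [Fin.succAbove_lt_succAbove_iff, Fin.succAbove_lt_iff_castSucc_lt,
        Fin.lt_succAbove_iff_le_castSucc] using h₂ i j j' hij hj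
    | cast k =>
      simpa [Fin.succAbove_lt_succAbove_iff] using h₁ i j j' k hij hj (by simpa using hk)

/-- The new step leaves position `m`, counted from `0`, so the parity of `m` decides its direction.
-/
theorem isAlternating_appendLast {m : ℕ} (π : Equiv.Perm (Fin (m + 1))) (v : Fin (m + 2)) :
    IsAlternating (appendLast π v) ↔ IsAlternating π ∧
      (Even m → (π (Fin.last m)).castSucc < v) ∧ (Odd m → v ≤ (π (Fin.last m)).castSucc) := by
  constructor
  · intro h
    constructor
    · intro i i' hi
      have := h i.castSucc i'.castSucc (by simpa)
      simpa [Fin.succAbove_lt_succAbove_iff] using this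
    · have := h (Fin.last m).castSucc (Fin.last (m + 1)) (by simp)
      simpa [Fin.succAbove_lt_iff_castSucc_lt, Fin.lt_succAbove_iff_le_castSucc] using this
  · rintro ⟨h₁, h₂⟩ i i' hi
    have hii' : i < i' := by rw [Fin.lt_def]; omega
    obtain ⟨i, rfl⟩ := Fin.exists_castSucc_eq.2 (ne_of_lt (hii'.trans_le (Fin.le_last _)))
    induction i' using Fin.lastCases with
    | last =>
      obtain rfl : i = Fin.last m := by
        ext; simpa using hi.symm
      simpa [Fin.succAbove_lt_iff_castSucc_lt, Fin.lt_succAbove_iff_le_castSucc] using h₂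
    | cast i' =>
      simpa [Fin.succAbove_lt_succAbove_iff] using h₁ i i' (by simpa using hi)

/-! ### Right-to-left minima and maxima -/

/-- The values of the right-to-left minima of `π`. -/
def rlMin {m : ℕ} (π : Equiv.Perm (Fin m)) : Finset (Fin m) :=
  univ.filter fun w => ∀ j, π.symm w < j → w < π j

/-- The values of the right-to-left maxima of `π`. -/
def rlMax {m : ℕ} (π : Equiv.Perm (Fin m)) : Finset (Fin m) :=
  univ.filter fun w => ∀ j, π.symm w < j → π j < w

theorem mem_rlMin {m : ℕ} {π : Equiv.Perm (Fin m)} {w : Fin m} :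
    w ∈ rlMin π ↔ ∀ j, π.symm w < j → w < π j := by simp [rlMin]

theorem mem_rlMax {m : ℕ} {π : Equiv.Perm (Fin m)} {w : Fin m} :
    w ∈ rlMax π ↔ ∀ j, π.symm w < j → π j < w := by simp [rlMax]

theorem apply_mem_rlMin {m : ℕ} {π : Equiv.Perm (Fin m)} {q : Fin m} :
    π q ∈ rlMin π ↔ ∀ j, q < j → π q < π j := by simp [rlMin]

theorem apply_mem_rlMax {m : ℕ} {π : Equiv.Perm (Fin m)} {q : Fin m} :
    π q ∈ rlMax π ↔ ∀ j, q < j → π j < π q := by simp [rlMax]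

theorem le_last_of_mem_rlMin {m : ℕ} {π : Equiv.Perm (Fin (m + 1))} {w : Fin (m + 1)}
    (hw : w ∈ rlMin π) : w ≤ π (Fin.last m) := by
  obtain ⟨q, rfl⟩ := π.surjective w
  rcases (Fin.le_last q).eq_or_lt with rfl | h
  · exact le_rfl
  · exact (apply_mem_rlMin.1 hw _ h).le

theorem last_le_of_mem_rlMax {m : ℕ} {π : Equiv.Perm (Fin (m + 1))} {w : Fin (m + 1)}
    (hw : w ∈ rlMax π) : π (Fin.last m) ≤ w := by
  obtain ⟨q, rfl⟩ := π.surjective w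
  rcases (Fin.le_last q).eq_or_lt with rfl | h
  · exact le_rfl
  · exact (apply_mem_rlMax.1 hw _ h).le

/-! ### Admissible last entries and the succession rule -/

/-- A sequence that is below `w` somewhere and ends at or above `w` crosses `w` upwards. -/
theorem exists_crossing {m : ℕ} {f : Fin (m + 1) → Fin (m + 1)} {p w : Fin (m + 1)}
    (hp : f p < w) (hlast : w ≤ f (Fin.last m)) :
    ∃ j j' : Fin (m + 1), p ≤ j ∧ (j' : ℕ) = (j : ℕ) + 1 ∧ f j < w ∧ w ≤ f j' := by
  by_contra! h
  have key : ∀ n, (p : ℕ) ≤ n → ∀ hn : n < m + 1, f ⟨n, hn⟩ < w := by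
    intro n hpn
    induction n, hpn using Nat.le_induction with
    | base => intro _; exact hp
    | succ n hpn ih =>
      intro hn
      exact h ⟨n, by omega⟩ ⟨n + 1, hn⟩ hpn rfl (ih (by omega))
  exact absurd hlast (not_le.2 (key m (Nat.lt_succ_iff.1 p.2) (by omega)))

theorem avoidsLast_castSucc_iff {m : ℕ} {π : Equiv.Perm (Fin (m + 1))} (hπ : IsBaxter π)
    {w : Fin (m + 1)} (hw : w ≤ π (Fin.last m)) :
    AvoidsLast π w.castSucc ↔ w ∈ rlMin π := by
  obtain ⟨q, rfl⟩ := π.surjective w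
  rw [apply_mem_rlMin]
  simp only [AvoidsLast, Fin.castSucc_lt_castSucc_iff, Fin.castSucc_le_castSucc_iff]
  constructor
  · intro h p hp
    by_contra hlt
    have hpq : π p < π q := lt_of_le_of_ne (not_lt.1 hlt) (fun e => hp.ne' (π.injective e))
    -- A smaller entry after `q` forces an upward crossing of `π q`, which completes a 3-14-2 with
    -- `q` and the new last entry.
    obtain ⟨j, j', hpj, hj, h₁, h₂⟩ := exists_crossing hpq hw
    have hqj : q < j := hp.trans_le hpj
    have hne : q ≠ j' := by intro e; subst e; rw [Fin.lt_def] at hqj; omega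
    exact (h q j j' hqj hj).2
      ⟨lt_of_le_of_ne h₂ (fun e => hne (π.injective e)), le_rfl, h₁⟩
  · intro h i j j' hij hj
    -- All entries below the right-to-left minimum `π q` precede it, so in a forbidden pattern `q`
    -- can replace the new last entry.
    have hlt : ∀ x, π x < π q → x < q := by
      intro x hx
      by_contra hxq
      rcases (not_lt.1 hxq).eq_or_lt with rfl | h'
      · exact lt_irrefl _ hx
      · exact lt_asymm hx (h x h')
    constructor
    · rintro ⟨h₁, h₂, h₃⟩
      have hj'q := hlt j' (h₁.trans h₂)
      have hne : π q ≠ π j := by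
        intro e
        have := π.injective e
        subst this
        rw [Fin.lt_def] at hj'q; omega
      exact (hπ i j j' q hij hj hj'q).1 ⟨h₁, h₂, lt_of_le_of_ne h₃ hne⟩
    · rintro ⟨h₁, h₂, h₃⟩
      have hjq := hlt j h₃
      have hne : π q ≠ π i := fun e => (hij.trans hjq).ne' (π.injective e)
      have h₂' := lt_of_le_of_ne h₂ hne
      have hj'q : j' < q := by
        have : j' ≠ q := by rintro rfl; exact lt_asymm h₁ h₂'
        rw [Fin.lt_def] at hjq ⊢
        have : (j' : ℕ) ≠ q := fun e => this (Fin.ext e)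
        omega
      exact (hπ i j j' q hij hj hj'q).2 ⟨h₁, h₂', h₃⟩

/-- Minima below `w` survive, those above are destroyed, and the new entry takes the place of `w`;
the count is the rank of `w`. -/
theorem rlMin_appendLast {m : ℕ} {π : Equiv.Perm (Fin (m + 1))} {w : Fin (m + 1)}
    (hw : w ∈ rlMin π) :
    (rlMin (appendLast π w.castSucc)).card = ((rlMin π).filter (· ≤ w)).card := by
  have : rlMin (appendLast π w.castSucc) = ((rlMin π).filter (· ≤ w)).map Fin.castSuccEmb := by
    ext x
    obtain ⟨q, rfl⟩ := (appendLast π w.castSucc).surjective x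
    rw [apply_mem_rlMin]
    simp only [mem_map, mem_filter, Fin.coe_castSuccEmb]
    induction q using Fin.lastCases with
    | last =>
      simp only [appendLast_last]
      constructor
      · intro _
        exact ⟨w, ⟨hw, le_rfl⟩, rfl⟩
      · intro _ j hj
        exact absurd hj (not_lt.2 (Fin.le_last j))
    | cast q =>
      simp only [appendLast_castSucc]
      constructor
      · intro h
        have h₁ := h (Fin.last _) (Fin.castSucc_lt_last _)
        rw [appendLast_last, Fin.succAbove_lt_iff_castSucc_lt, Fin.castSucc_lt_castSucc_iff] at h₁
        refine ⟨π q, ⟨apply_mem_rlMin.2 fun j hj => ?_, h₁.le⟩, ?_⟩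
        · simpa [Fin.succAbove_lt_succAbove_iff] using h j.castSucc (by simpa)
        · rw [Fin.succAbove_of_castSucc_lt _ _ (by simpa)]
      · rintro ⟨u, ⟨hu, huw⟩, he⟩
        have hne := Fin.succAbove_ne w.castSucc (π q)
        have hlt : u < w := lt_of_le_of_ne huw (by rintro rfl; exact hne he.symm)
        obtain rfl : u = π q := by
          apply (Fin.succAbove_right_injective (p := w.castSucc))
          rw [← he, Fin.succAbove_of_castSucc_lt _ _ (by simpa)]
        intro j hj
        induction j using Fin.lastCases with
        | last => simpa [Fin.succAbove_lt_iff_castSucc_lt] using hlt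
        | cast j =>
          simpa [Fin.succAbove_lt_succAbove_iff] using apply_mem_rlMin.1 hu j (by simpa using hj)
  rw [this, card_map]

/-- Every right-to-left maximum is at least the old last entry, so all survive and the new entry is
one more. -/
theorem rlMax_appendLast {m : ℕ} {π : Equiv.Perm (Fin (m + 1))} {w : Fin (m + 1)}
    (hw : w ≤ π (Fin.last m)) :
    (rlMax (appendLast π w.castSucc)).card = (rlMax π).card + 1 := by
  have : rlMax (appendLast π w.castSucc) =
      insert w.castSucc ((rlMax π).map (w.castSucc.succAboveEmb)) := by
    ext x
    obtain ⟨q, rfl⟩ := (appendLast π w.castSucc).surjective x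
    rw [apply_mem_rlMax]
    simp only [mem_insert, mem_map, Fin.succAboveEmb_apply]
    induction q using Fin.lastCases with
    | last =>
      simp only [appendLast_last, true_or, iff_true]
      intro j hj
      exact absurd hj (not_lt.2 (Fin.le_last j))
    | cast q =>
      simp only [appendLast_castSucc, Fin.succAbove_ne, false_or,
        Fin.succAbove_right_inj, exists_eq_right]
      constructor
      · intro h
        refine apply_mem_rlMax.2 fun j hj => ?_
        simpa [Fin.succAbove_lt_succAbove_iff] using h j.castSucc (by simpa)
      · intro h j hj
        induction j using Fin.lastCases with
        | last =>
          simpa [Fin.lt_succAbove_iff_le_castSucc] using hw.trans (last_le_of_mem_rlMax h)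
        | cast j =>
          simpa [Fin.succAbove_lt_succAbove_iff] using apply_mem_rlMax.1 h j (by simpa using hj)
  rw [this, card_insert_of_notMem, card_map]
  simp [Fin.succAbove_ne]

/-- Summing over a finite chain a function of the rank. -/
theorem sum_card_filter_le {α : Type*} [LinearOrder α] (s : Finset α) (f : ℕ → ℕ) :
    ∑ w ∈ s, f (s.filter (· ≤ w)).card = ∑ i ∈ Icc 1 s.card, f i := by
  refine Finset.induction_on_max s (by simp) fun a s ha ih => ?_
  have hnot : a ∉ s := fun h => lt_irrefl _ (ha a h)
  rw [sum_insert hnot, card_insert_of_notMem hnot, sum_Icc_succ_top (by omega), ← ih, add_comm]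
  congr 1
  · refine sum_congr rfl fun w hw => ?_
    rw [filter_insert, if_neg (not_le.2 (ha w hw))]
  · rw [filter_true_of_mem, card_insert_of_notMem hnot]
    intro x hx
    rcases mem_insert.1 hx with rfl | hx
    · exact le_rfl
    · exact (ha x hx).le

open Classical in
theorem sum_descent {m : ℕ} {π : Equiv.Perm (Fin (m + 1))} (hπ : IsBaxter π) (F : ℕ → ℕ → ℕ) :
    (∑ v : Fin (m + 2), if AvoidsLast π v ∧ v ≤ (π (Fin.last m)).castSucc then
        F (rlMin (appendLast π v)).card (rlMax (appendLast π v)).card else 0) =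
      ∑ i ∈ Icc 1 (rlMin π).card, F i ((rlMax π).card + 1) := by
  rw [← sum_card_filter_le (rlMin π) (fun i => F i ((rlMax π).card + 1)),
    Fin.sum_univ_castSucc, if_neg, add_zero]
  · rw [← sum_filter]
    refine sum_congr ?_ fun w hw => ?_
    · ext w
      simp only [mem_filter, mem_univ, true_and, Fin.castSucc_le_castSucc_iff]
      constructor
      · rintro ⟨h₁, h₂⟩
        exact (avoidsLast_castSucc_iff hπ h₂).1 h₁
      · intro h
        exact ⟨(avoidsLast_castSucc_iff hπ (le_last_of_mem_rlMin h)).2 h, le_last_of_mem_rlMin h⟩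
    · rw [rlMin_appendLast hw, rlMax_appendLast (le_last_of_mem_rlMin hw)]
  · rintro ⟨-, h⟩
    exact absurd (Fin.castSucc_lt_last _) (not_lt.2 h)

/-! ### Complementation -/

/-- The complement of a permutation. -/
def compl {m : ℕ} (π : Equiv.Perm (Fin m)) : Equiv.Perm (Fin m) := π.trans Fin.revPerm

@[simp]
theorem compl_apply {m : ℕ} (π : Equiv.Perm (Fin m)) (i : Fin m) : compl π i = (π i).rev := rfl

theorem isBaxter_compl {m : ℕ} {π : Equiv.Perm (Fin m)} (hπ : IsBaxter π) :
    IsBaxter (compl π) := by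
  intro i j j' k hij hj hk
  have := hπ i j j' k hij hj hk
  simp only [compl_apply, gt_iff_lt, Fin.rev_lt_rev] at this ⊢
  tauto

theorem rev_succAbove_rev {m : ℕ} (v : Fin (m + 1)) (x : Fin m) :
    v.rev.succAbove x.rev = (v.succAbove x).rev := by
  rw [Fin.rev_succAbove]

theorem compl_appendLast {m : ℕ} (π : Equiv.Perm (Fin m)) (v : Fin (m + 1)) :
    appendLast (compl π) v.rev = compl (appendLast π v) := by
  ext1 i
  induction i using Fin.lastCases with
  | last => simp
  | cast i => simp [rev_succAbove_rev]

theorem card_rlMin_compl {m : ℕ} (π : Equiv.Perm (Fin m)) :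
    (rlMin (compl π)).card = (rlMax π).card := by
  have : rlMin (compl π) = (rlMax π).map Fin.revPerm.toEmbedding := by
    ext x
    obtain ⟨q, rfl⟩ := (compl π).surjective x
    rw [apply_mem_rlMin]
    simp [apply_mem_rlMax]
  rw [this, card_map]

theorem card_rlMax_compl {m : ℕ} (π : Equiv.Perm (Fin m)) :
    (rlMax (compl π)).card = (rlMin π).card := by
  have : rlMax (compl π) = (rlMin π).map Fin.revPerm.toEmbedding := by
    ext x
    obtain ⟨q, rfl⟩ := (compl π).surjective x
    rw [apply_mem_rlMax]
    simp [apply_mem_rlMin]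
  rw [this, card_map]

theorem avoidsLast_compl {m : ℕ} (π : Equiv.Perm (Fin m)) (v : Fin (m + 1)) :
    AvoidsLast (compl π) v.rev ↔ AvoidsLast π v := by
  simp only [AvoidsLast, compl_apply, Fin.lt_def, Fin.le_def, Fin.val_rev,
    Fin.val_castSucc]
  refine forall_congr' fun i => forall_congr' fun j => forall_congr' fun j' =>
    forall_congr' fun _ => forall_congr' fun _ => ?_
  have := (π i).2
  have := (π j).2
  have := (π j').2
  have := v.2
  omega

open Classical in
theorem sum_ascent {m : ℕ} {π : Equiv.Perm (Fin (m + 1))} (hπ : IsBaxter π) (F : ℕ → ℕ → ℕ) :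
    (∑ v : Fin (m + 2), if AvoidsLast π v ∧ (π (Fin.last m)).castSucc < v then
        F (rlMin (appendLast π v)).card (rlMax (appendLast π v)).card else 0) =
      ∑ j ∈ Icc 1 (rlMax π).card, F ((rlMin π).card + 1) j := by
  have h := sum_descent (isBaxter_compl hπ) (fun i j => F j i)
  rw [card_rlMin_compl, card_rlMax_compl] at h
  rw [← h, ← Equiv.sum_comp Fin.revPerm]
  refine sum_congr rfl fun v _ => ?_
  obtain ⟨v, rfl⟩ := Fin.rev_surjective v
  have hlt : (π (Fin.last m)).castSucc < v ↔
      v.rev ≤ (compl π (Fin.last m)).castSucc := by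
    simp only [compl_apply, Fin.lt_def, Fin.le_def, Fin.val_rev, Fin.val_castSucc]
    have := (π (Fin.last m)).2
    have := v.2
    omega
  simp only [Fin.revPerm_apply, Fin.rev_rev, compl_appendLast, card_rlMin_compl,
    card_rlMax_compl, avoidsLast_compl, hlt]

/-! ### Weighted enumeration -/

open Classical in
/-- The sum of `F` over the numbers of right-to-left minima and maxima of the alternating Baxter
permutations of `m` letters. -/
noncomputable def weight (m : ℕ) (F : ℕ → ℕ → ℕ) : ℕ :=
  ∑ π : Equiv.Perm (Fin m), if IsBaxter π ∧ IsAlternating π then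
    F (rlMin π).card (rlMax π).card else 0

theorem natCard_eq_weight (m : ℕ) :
    Nat.card {π : Equiv.Perm (Fin m) // IsBaxter π ∧ IsAlternating π} =
      weight m (fun _ _ => 1) := by
  classical
  rw [Nat.card_eq_fintype_card, Fintype.card_subtype, weight, sum_boole, Nat.cast_id]

theorem weight_one (F : ℕ → ℕ → ℕ) : weight 1 F = F 1 1 := by
  rw [weight, Fintype.sum_unique, if_pos]
  · have h₁ : rlMin (default : Equiv.Perm (Fin 1)) = univ := by
      ext x; simp only [mem_rlMin, mem_univ, iff_true]
      intro j hj; exact absurd hj (by simp [Subsingleton.elim _ j])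
    have h₂ : rlMax (default : Equiv.Perm (Fin 1)) = univ := by
      ext x; simp only [mem_rlMax, mem_univ, iff_true]
      intro j hj; exact absurd hj (by simp [Subsingleton.elim _ j])
    rw [h₁, h₂]; rfl
  · constructor
    · intro i j _ _ hij
      exact absurd hij (by simp [Subsingleton.elim i j])
    · intro i i' h
      omega

/-- Peeling off the last rise turns into an operator on the test function `F`. -/
theorem weight_succ_of_even {m : ℕ} (hm : Even m) (F : ℕ → ℕ → ℕ) :
    weight (m + 2) F = weight (m + 1) (fun i j => ∑ j' ∈ Icc 1 j, F (i + 1) j') := by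
  classical
  rw [weight, sum_perm_succ, weight]
  refine sum_congr rfl fun π _ => ?_
  simp only [isBaxter_appendLast, isAlternating_appendLast, hm, Nat.not_odd_iff_even.2 hm,
    true_implies, false_implies, and_true]
  split_ifs with h
  · rw [← sum_ascent h.1]
    refine sum_congr rfl fun v _ => ?_
    simp only [h.1, h.2, true_and]
  · refine sum_eq_zero fun v _ => if_neg ?_
    tauto

theorem weight_succ_of_odd {m : ℕ} (hm : Odd m) (F : ℕ → ℕ → ℕ) :
    weight (m + 2) F = weight (m + 1) (fun i j => ∑ i' ∈ Icc 1 i, F i' (j + 1)) := by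
  classical
  rw [weight, sum_perm_succ, weight]
  refine sum_congr rfl fun π _ => ?_
  simp only [isBaxter_appendLast, isAlternating_appendLast, hm, Nat.not_even_iff_odd.2 hm,
    true_implies, false_implies, true_and]
  split_ifs with h
  · rw [← sum_descent h.1]
    refine sum_congr rfl fun v _ => ?_
    simp only [h.1, h.2, true_and]
  · refine sum_eq_zero fun v _ => if_neg ?_
    tauto

/-! ### Ballot numbers -/

/-- The number of nodes at depth `r` below a node with label `i` in the Catalan tree, in which a
node labelled `i` has children labelled `1, …, i + 1`. -/
def ballot : ℕ → ℕ → ℕ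
  | 0, _ => 1
  | r + 1, i => ∑ i' ∈ Icc 1 (i + 1), ballot r i'

/-- The reflection formula for ballot numbers, written without subtraction; Pascal's rule matches
the recurrence `h₁` in `i`. -/
theorem ballot_add_choose (r i : ℕ) :
    ballot (r + 1) i + (2 * r + 2 + i).choose r = (2 * r + 2 + i).choose (r + 1) := by
  induction r generalizing i with
  | zero => simp [ballot]; omega
  | succ r ihr =>
    induction i with
    | zero =>
      have h := ihr 1
      have h₁ : ballot (r + 1 + 1) 0 = ballot (r + 1) 1 := by simp [ballot]
      have h₂ := Nat.choose_succ_succ' (2 * r + 3) (r + 1)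
      have h₃ := Nat.choose_succ_succ' (2 * r + 3) r
      have h₄ : (2 * r + 3).choose (r + 1 + 1) = (2 * r + 3).choose (r + 1) :=
        Nat.choose_symm_of_eq_add (by omega)
      rw [h₁, show 2 * (r + 1) + 2 + 0 = 2 * r + 3 + 1 by omega]
      rw [show 2 * r + 2 + 1 = 2 * r + 3 by omega] at h
      omega
    | succ i ihi =>
      have h := ihr (i + 2)
      have h₁ : ballot (r + 1 + 1) (i + 1) = ballot (r + 1 + 1) i + ballot (r + 1) (i + 2) := by
        rw [ballot, sum_Icc_succ_top (by omega)]; rfl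
      have h₂ := Nat.choose_succ_succ' (2 * r + 4 + i) (r + 1)
      have h₃ := Nat.choose_succ_succ' (2 * r + 4 + i) r
      rw [h₁, show 2 * (r + 1) + 2 + (i + 1) = 2 * r + 4 + i + 1 by omega]
      rw [show 2 * (r + 1) + 2 + i = 2 * r + 4 + i by omega] at ihi
      rw [show 2 * r + 2 + (i + 2) = 2 * r + 4 + i by omega] at h
      omega

theorem ballot_one (r : ℕ) : ballot r 1 = catalan (r + 1) := by
  cases r with
  | zero => simp [ballot]
  | succ r =>
    have h := ballot_add_choose r 1
    have hc := succ_mul_catalan_eq_centralBinom (r + 2)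
    have h₁ := Nat.choose_succ_succ' (2 * r + 3) (r + 1)
    have h₂ : (2 * r + 3).choose (r + 1 + 1) = (2 * r + 3).choose (r + 1) :=
      Nat.choose_symm_of_eq_add (by omega)
    have h₃ := Nat.choose_succ_right_eq (2 * r + 3) r
    rw [Nat.centralBinom_eq_two_mul_choose, show 2 * (r + 2) = 2 * r + 3 + 1 by omega] at hc
    rw [show 2 * r + 2 + 1 = 2 * r + 3 by omega] at h
    rw [show 2 * r + 3 - r = r + 3 by omega] at h₃
    apply Nat.eq_of_mul_eq_mul_left (show 0 < r + 2 + 1 by omega)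
    nlinarith

/-- The number of nodes at depth `r` below a node with label `j` in the Catalan tree, in which a
node labelled `j` has children labelled `2, …, j + 1`. -/
def shiftedBallot : ℕ → ℕ → ℕ
  | 0, _ => 1
  | r + 1, j => ∑ j' ∈ Icc 1 j, shiftedBallot r (j' + 1)

theorem shiftedBallot_succ (r j : ℕ) : shiftedBallot r (j + 1) = ballot r j := by
  induction r generalizing j with
  | zero => rfl
  | succ r ih => simp [shiftedBallot, ballot, ih]

theorem shiftedBallot_one (r : ℕ) : shiftedBallot r 1 = catalan r := by
  cases r with
  | zero => simp [shiftedBallot]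
  | succ r => simp [shiftedBallot, shiftedBallot_succ, ballot_one]

/-- General `s` and `t` make the induction close: peeling off a descent and a rise raises both by
one. -/
theorem weight_odd_length (r s t : ℕ) :
    weight (2 * r + 1) (fun i j => ballot s i * shiftedBallot t j) =
      ballot (r + s) 1 * shiftedBallot (r + t) 1 := by
  induction r generalizing s t with
  | zero => simp [weight_one]
  | succ r ih =>
    rw [show 2 * (r + 1) + 1 = 2 * r + 1 + 2 by omega,
      weight_succ_of_odd (odd_two_mul_add_one r), show 2 * r + 1 + 1 = 2 * r + 2 by omega,
      weight_succ_of_even (even_two_mul r), show r + 1 + s = r + (s + 1) by omega,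
      show r + 1 + t = r + (t + 1) by omega, ← ih (s + 1) (t + 1)]
    simp only [ballot, shiftedBallot, ← sum_mul, ← mul_sum]

theorem natCard_odd_length (r : ℕ) :
    Nat.card {π : Equiv.Perm (Fin (2 * r + 1)) // IsBaxter π ∧ IsAlternating π} =
      catalan r * catalan (r + 1) := by
  rw [natCard_eq_weight, mul_comm (catalan r), ← ballot_one, ← shiftedBallot_one]
  simpa [ballot, shiftedBallot] using weight_odd_length r 0 0

theorem natCard_even_length (r : ℕ) :
    Nat.card {π : Equiv.Perm (Fin (2 * r)) // IsBaxter π ∧ IsAlternating π} =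
      catalan r * catalan r := by
  rw [natCard_eq_weight]
  cases r with
  | zero =>
    rw [Nat.mul_zero, weight, Fintype.sum_unique, if_pos ⟨fun i => i.elim0, fun i => i.elim0⟩]
    simp
  | succ r =>
    nth_rewrite 1 [← ballot_one]
    rw [← shiftedBallot_one, show 2 * (r + 1) = 2 * r + 2 by omega,
      weight_succ_of_even (even_two_mul r)]
    -- The final rise has `j` choices, and `j = shiftedBallot 1 j`, whence `t = 1`.
    simpa [ballot, shiftedBallot] using weight_odd_length r 0 1

end AltBaxter

theorem mainTheorem7 (n k : ℕ) (hk : 1 ≤ k) :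
    (n = 2 * k →
      Nat.card {π : Equiv.Perm (Fin (n - 1)) //
        AltBaxter.IsBaxter π ∧ AltBaxter.IsAlternating π} = catalan (k - 1) * catalan k) ∧
    (n = 2 * k - 1 →
      Nat.card {π : Equiv.Perm (Fin (n - 1)) //
        AltBaxter.IsBaxter π ∧ AltBaxter.IsAlternating π} =
          catalan (k - 1) * catalan (k - 1)) := by
  obtain ⟨r, rfl⟩ := Nat.exists_eq_add_of_le' hk
  constructor
  · rintro rfl
    exact AltBaxter.natCard_odd_length r
  · rintro rfl
    exact AltBaxter.natCard_even_length r
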